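/- Let $A$ and $E$ be real $m\times n$ matrices, let $r$ be the rank of $A$, and let $\tilde A=A+E$. Let $\|\cdot\|$ be the spectral norm. Let $A=\sum_{i=1}^r\sigma_iu_iv_i^\top$ be a singular value decomposition, where $\sigma_1\ge\dots\ge\sigma_r>0$, the vectors $u_1,\dots,u_r\in\mathbb R^m$ are orthonormal and the vectors $v_1,\dots,v_r\in\mathbb R^n$ are orthonormal; put $\sigma_{r+1}=0$. Let $1\le p\le r$ and let $A_p=\sum_{i=1}^p\sigma_iu_iv_i^\top$. Similarly let $\tilde A=\sum_{i=1}^{\tilde r}\tilde\sigma_i\tilde u_i\tilde v_i^\top$, with $\tilde r$ the rank of $\tilde A$, be a singular value decomposition of $\tilde A$ (singular values in decreasing order), and let $\tilde A_p=\sum_{i\le \min(p,\tilde r)}\tilde\sigma_i\tilde u_i\tilde v_i^\top$. Define $$\delta_p=\sigma_p-\sigma_{p+1},\qquad x=\max_{1\le i,j\le r}|u_i^\top Ev_j|,\qquad y=\max_{1\le i<j\le r}\max\bigl\{|Ev_i\cdot Ev_j|,\ |E^\top u_i\cdot E^\top u_j|\bigr\},$$ where $y=0$ if $r=1$. Assume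 that $\delta_p>0$ and $$\max\left\{\frac{p\|E\|}{\sigma_p},\ \frac{r^2x}{\delta_p},\ \frac{\sqrt r\,\|E\|}{\sqrt{\sigma_p\delta_p}}\right\}\le\frac1{96}.$$ Then $$\|\tilde A_p-A_p\|\le 32\,\sigma_p\left(\frac{\|E\|}{\sigma_p}+\frac{rx}{\delta_p}+\frac{r^2y}{\sigma_p\delta_p}\right).$$ This holds for every choice of the two singular value decompositions. -/

import Mathlib

open scoped Matrix Matrix.Norms.L2Operator

noncomputable section

namespace LowRankPerturbation

variable {m n k : ℕ}

/-- The singular values of a real matrix in decreasing order, extended by zero, and indexed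
from `0`: what is usually written `σ_i` (`i ≥ 1`) is `singularValue A (i - 1)`. -/
def singularValue (A : Matrix (Fin m) (Fin n) ℝ) (i : ℕ) : ℝ :=
  (Matrix.toEuclideanLin A).singularValues i

/-- The singular value gap `δ_p = σ_p - σ_{p+1}`, for `p ≥ 1`. -/
def singularGap (A : Matrix (Fin m) (Fin n) ℝ) (p : ℕ) : ℝ :=
  singularValue A (p - 1) - singularValue A p

/-- `u` and `v` are left and right singular vectors of `A`: orthonormal families such that
`A = ∑ σ_i u_i v_iᵀ` is a singular value decomposition of `A` (used with `k = rank A`). -/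
structure IsSingularSystem (A : Matrix (Fin m) (Fin n) ℝ)
    (u : Fin k → EuclideanSpace ℝ (Fin m)) (v : Fin k → EuclideanSpace ℝ (Fin n)) : Prop where
  orthonormal_left : Orthonormal ℝ u
  orthonormal_right : Orthonormal ℝ v
  eq_sum : A = ∑ i : Fin k, singularValue A (i : ℕ) • Matrix.vecMulVec (u i).ofLp (v i).ofLp

/-- The truncation `∑_{i ≤ p} σ_i u_i v_iᵀ` of a singular value decomposition of `A`. -/
def truncation (A : Matrix (Fin m) (Fin n) ℝ)
    (u : Fin k → EuclideanSpace ℝ (Fin m)) (v : Fin k → EuclideanSpace ℝ (Fin n)) (p : ℕ) :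
    Matrix (Fin m) (Fin n) ℝ :=
  ∑ i ∈ Finset.univ.filter (fun i : Fin k => (i : ℕ) < p),
    singularValue A (i : ℕ) • Matrix.vecMulVec (u i).ofLp (v i).ofLp

/-- The skewness parameter `x = max_{i, j} |u_iᵀ E v_j|`. -/
def skewX (E : Matrix (Fin m) (Fin n) ℝ)
    (u : Fin k → EuclideanSpace ℝ (Fin m)) (v : Fin k → EuclideanSpace ℝ (Fin n)) : ℝ :=
  ⨆ q : Fin k × Fin k, |(u q.1).ofLp ⬝ᵥ (E *ᵥ (v q.2).ofLp)|

/-- The skewness parameter `y = max_{i < j} max {|E v_i · E v_j|, |Eᵀ u_i · Eᵀ u_j|}`. If there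
is no pair `i < j`, that is, if `k ≤ 1`, it is `0`. -/
def skewY (E : Matrix (Fin m) (Fin n) ℝ)
    (u : Fin k → EuclideanSpace ℝ (Fin m)) (v : Fin k → EuclideanSpace ℝ (Fin n)) : ℝ :=
  ⨆ q : {q : Fin k × Fin k // q.1 < q.2},
    max |(E *ᵥ (v q.1.1).ofLp) ⬝ᵥ (E *ᵥ (v q.1.2).ofLp)|
      |(Eᵀ *ᵥ (u q.1.1).ofLp) ⬝ᵥ (Eᵀ *ᵥ (u q.1.2).ofLp)|

end LowRankPerturbation

end

/-! Write A = U diag(σ) Vᵀ and B = A + E. Let U', V' hold the leading p singular vectors of B, with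
values τ, and let Q be the coordinate projection onto the indices beyond p. The overlaps a = UᵀU'
and c = VᵀV' satisfy a·diag(τ) = diag(σ)·c + UᵀEV' and c·diag(τ) = diag(σ)·a + VᵀEᵀU'. Adding
absolute values entrywise bounds (τ_k - σ_j)(|a_jk| + |c_jk|) by the entries of the two interaction
terms, so the gap times the Frobenius size of Qa and Qc is controlled by those terms
(`exists_frob_mask_le`).

The interactions involve unknown vectors, but outside the column space of V one has V' = Eᵀ U'
diag(τ)⁻¹ up to projection. Substituting this, and then its mirror image for U', turns UᵀEV' into
UᵀEV (size r x), the off-diagonal part of UᵀEEᵀU (size r y), its diagonal part, and a third-order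
remainder (`frob_mask_mul_le`). The diagonal part commutes with Q, so it only multiplies Qa by
‖E‖²/σ_p, which is small against the gap and is absorbed on the left.

The gap survives because the p-th singular value drops by at most p x
(`IsFactorization.sub_le_of_entries`). Weyl's inequality would lose ‖E‖, which may exceed δ_p.
Finally `norm_truncation_sub_le` splits the difference of truncations into 2‖E‖ plus singular values
times sines of angles. -/

namespace LowRankPerturbation

set_option linter.unusedSectionVars false

/-! ### Spectral and Frobenius norms, isometries -/

section Norms

variable {ι κ l : Type*} [Fintype ι] [Fintype κ] [Fintype l]
  [DecidableEq ι] [DecidableEq κ] [DecidableEq l]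

lemma norm_toLp_sq (z : ι → ℝ) : ‖WithLp.toLp 2 z‖ ^ 2 = z ⬝ᵥ z := by
  rw [EuclideanSpace.real_norm_sq_eq]
  simp [dotProduct, sq]

lemma dotProduct_self_nonneg' (z : ι → ℝ) : 0 ≤ z ⬝ᵥ z := by
  rw [← norm_toLp_sq]; positivity

lemma mulVec_dotProduct_self_le (M : Matrix ι κ ℝ) (z : κ → ℝ) :
    (M *ᵥ z) ⬝ᵥ (M *ᵥ z) ≤ ‖M‖ ^ 2 * (z ⬝ᵥ z) := by
  have h := Matrix.l2_opNorm_mulVec M (WithLp.toLp 2 z)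
  have h2 := pow_le_pow_left₀ (norm_nonneg _) h 2
  rw [mul_pow, norm_toLp_sq z] at h2
  refine le_trans (le_of_eq ?_) h2
  rw [← norm_toLp_sq]
  rfl

lemma l2_opNorm_le_of_forall (M : Matrix ι κ ℝ) {c : ℝ} (hc : 0 ≤ c)
    (h : ∀ z : κ → ℝ, (M *ᵥ z) ⬝ᵥ (M *ᵥ z) ≤ c ^ 2 * (z ⬝ᵥ z)) : ‖M‖ ≤ c := by
  rw [Matrix.l2_opNorm_def]
  refine ContinuousLinearMap.opNorm_le_bound _ hc fun z => ?_
  refine le_of_sq_le_sq ?_ (by positivity)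
  have := h z.ofLp
  rw [← norm_toLp_sq, ← norm_toLp_sq] at this
  rw [mul_pow]
  exact this

lemma l2_opNorm_transpose (M : Matrix ι κ ℝ) : ‖Mᵀ‖ = ‖M‖ := by
  rw [← Matrix.conjTranspose_eq_transpose_of_trivial, Matrix.l2_opNorm_conjTranspose]

lemma l2_opNorm_diagonal_le {d : ι → ℝ} {c : ℝ} (hc : 0 ≤ c) (h : ∀ i, |d i| ≤ c) :
    ‖Matrix.diagonal d‖ ≤ c := by
  rw [Matrix.l2_opNorm_diagonal]
  exact (pi_norm_le_iff_of_nonneg hc).2 h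

/-- A matrix with orthonormal columns is an isometry. -/
lemma mulVec_dotProduct_mulVec_of_isometry {M : Matrix ι κ ℝ} (hM : Mᵀ * M = 1) (z w : κ → ℝ) :
    (M *ᵥ z) ⬝ᵥ (M *ᵥ w) = z ⬝ᵥ w := by
  rw [Matrix.dotProduct_mulVec, Matrix.vecMul_mulVec, hM, Matrix.vecMul_one]

lemma l2_opNorm_le_one_of_isometry {M : Matrix ι κ ℝ} (hM : Mᵀ * M = 1) : ‖M‖ ≤ 1 :=
  l2_opNorm_le_of_forall _ zero_le_one fun z => by
    rw [mulVec_dotProduct_mulVec_of_isometry hM]; simp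

/-- Pythagoras' theorem for the complement of the column space of an isometry. -/
lemma one_sub_mulVec_dotProduct_self {M : Matrix ι κ ℝ} (hM : Mᵀ * M = 1) (z : ι → ℝ) :
    ((1 - M * Mᵀ) *ᵥ z) ⬝ᵥ ((1 - M * Mᵀ) *ᵥ z) = z ⬝ᵥ z - (Mᵀ *ᵥ z) ⬝ᵥ (Mᵀ *ᵥ z) := by
  have h1 : (M *ᵥ (Mᵀ *ᵥ z)) ⬝ᵥ z = (Mᵀ *ᵥ z) ⬝ᵥ (Mᵀ *ᵥ z) := by
    rw [dotProduct_comm, Matrix.dotProduct_mulVec, ← Matrix.mulVec_transpose]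
  rw [Matrix.sub_mulVec, Matrix.one_mulVec, ← Matrix.mulVec_mulVec, sub_dotProduct,
    dotProduct_sub, dotProduct_sub, mulVec_dotProduct_mulVec_of_isometry hM, dotProduct_comm z (_ *ᵥ _), h1]
  ring

lemma l2_opNorm_one_sub_le {M : Matrix ι κ ℝ} (hM : Mᵀ * M = 1) : ‖1 - M * Mᵀ‖ ≤ 1 :=
  l2_opNorm_le_of_forall _ zero_le_one fun z => by
    rw [one_sub_mulVec_dotProduct_self hM]
    have := dotProduct_self_nonneg' (Mᵀ *ᵥ z)
    linarith

lemma l2_opNorm_mul_le {M : Matrix ι κ ℝ} {N : Matrix κ l ℝ} {a b : ℝ}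
    (hM : ‖M‖ ≤ a) (hN : ‖N‖ ≤ b) : ‖M * N‖ ≤ a * b :=
  (Matrix.l2_opNorm_mul M N).trans
    (mul_le_mul hM hN (norm_nonneg _) ((norm_nonneg _).trans hM))

/-- The Frobenius norm. -/
noncomputable def frob (M : Matrix ι κ ℝ) : ℝ := √(∑ i, ∑ j, M i j ^ 2)

lemma frob_nonneg (M : Matrix ι κ ℝ) : 0 ≤ frob M := Real.sqrt_nonneg _

lemma frob_sq (M : Matrix ι κ ℝ) : frob M ^ 2 = ∑ i, ∑ j, M i j ^ 2 :=
  Real.sq_sqrt (by positivity)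

/-- This monotonicity, which the spectral norm does not have, is why the angles are estimated in
Frobenius norm. -/
lemma frob_le_frob {M N : Matrix ι κ ℝ} (h : ∀ i j, |M i j| ≤ N i j) : frob M ≤ frob N := by
  refine Real.sqrt_le_sqrt (Finset.sum_le_sum fun i _ => Finset.sum_le_sum fun j _ => ?_)
  exact sq_le_sq' (by linarith [neg_abs_le (M i j), h i j]) ((le_abs_self _).trans (h i j))

lemma frob_eq_norm (M : Matrix ι κ ℝ) :
    frob M = ‖WithLp.toLp 2 (fun q : ι × κ => M q.1 q.2)‖ := by
  rw [EuclideanSpace.norm_eq, frob, Fintype.sum_prod_type]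
  simp

lemma frob_add_le (M N : Matrix ι κ ℝ) : frob (M + N) ≤ frob M + frob N := by
  simp only [frob_eq_norm]
  exact norm_add_le (WithLp.toLp 2 fun q : ι × κ => M q.1 q.2)
    (WithLp.toLp 2 fun q : ι × κ => N q.1 q.2)

lemma frob_neg (M : Matrix ι κ ℝ) : frob (-M) = frob M := by simp [frob]

lemma frob_sub_le (M N : Matrix ι κ ℝ) : frob (M - N) ≤ frob M + frob N := by
  rw [sub_eq_add_neg, ← frob_neg N]
  exact frob_add_le _ _

lemma frob_abs (M : Matrix ι κ ℝ) : frob (M.map abs) = frob M := by simp [frob]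

lemma frob_smul {c : ℝ} (hc : 0 ≤ c) (M : Matrix ι κ ℝ) : frob (c • M) = c * frob M := by
  simp [frob, mul_pow, ← Finset.mul_sum, Real.sqrt_mul (sq_nonneg c), Real.sqrt_sq hc]

lemma frob_transpose (M : Matrix ι κ ℝ) : frob Mᵀ = frob M := by
  simp only [frob, Matrix.transpose_apply]
  rw [Finset.sum_comm]

/-- The squared Frobenius norm sums the squared lengths of the columns, and each column is stretched
by at most ‖M‖. -/
lemma frob_mul_le (M : Matrix ι κ ℝ) (N : Matrix κ l ℝ) : frob (M * N) ≤ ‖M‖ * frob N := by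
  refine le_of_sq_le_sq ?_ (mul_nonneg (norm_nonneg _) (frob_nonneg _))
  rw [mul_pow, frob_sq, frob_sq, Finset.sum_comm, Finset.sum_comm (γ := κ), Finset.mul_sum]
  refine Finset.sum_le_sum fun j _ => ?_
  have := mulVec_dotProduct_self_le M (fun i => N i j)
  simp only [dotProduct, ← sq] at this
  exact this

lemma frob_mul_le' (M : Matrix ι κ ℝ) (N : Matrix κ l ℝ) : frob (M * N) ≤ frob M * ‖N‖ := by
  rw [← frob_transpose, Matrix.transpose_mul, mul_comm, ← l2_opNorm_transpose N,
    ← frob_transpose M]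
  exact frob_mul_le _ _

lemma l2_opNorm_le_frob (M : Matrix ι κ ℝ) : ‖M‖ ≤ frob M :=
  l2_opNorm_le_of_forall _ (frob_nonneg _) fun z => by
    rw [frob_sq, Finset.sum_mul, dotProduct]
    refine Finset.sum_le_sum fun i _ => ?_
    rw [← sq]
    simpa [Matrix.mulVec, dotProduct, sq] using
      Finset.sum_mul_sq_le_sq_mul_sq Finset.univ (M i) z

lemma frob_le_of_forall_le (M : Matrix ι ι ℝ) {c : ℝ} (hc : 0 ≤ c) (h : ∀ i j, |M i j| ≤ c) :
    frob M ≤ Fintype.card ι * c := by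
  have h1 : frob M ≤ frob (Matrix.of fun _ _ : ι => c) := frob_le_frob h
  refine h1.trans (le_of_eq ?_)
  simp only [frob, Matrix.of_apply, Finset.sum_const, Finset.card_univ, nsmul_eq_mul]
  rw [← mul_assoc, ← sq, ← mul_pow, Real.sqrt_sq (by positivity)]

lemma frob_le_sqrt_card_mul (M : Matrix ι κ ℝ) : frob M ≤ √(Fintype.card κ) * ‖M‖ := by
  have h := frob_mul_le M (1 : Matrix κ κ ℝ)
  have h1 : frob (1 : Matrix κ κ ℝ) = √(Fintype.card κ) := by
    simp [frob, Matrix.one_apply, ite_pow]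
  rwa [Matrix.mul_one, h1, mul_comm] at h

end Norms

/-- Orthogonal projections of equal rank: the sine of the largest principal angle is symmetric. -/
lemma l2_opNorm_one_sub_mul_le_symm {ι κ : Type*} [Fintype ι] [Fintype κ]
    [DecidableEq ι] [DecidableEq κ] {V W : Matrix ι κ ℝ} (hV : Vᵀ * V = 1) (hW : Wᵀ * W = 1)
    {s : ℝ} (h : ‖(1 - V * Vᵀ) * W‖ ≤ s) : ‖(1 - W * Wᵀ) * V‖ ≤ s := by
  have hs : 0 ≤ s := (norm_nonneg _).trans h
  rcases le_or_gt 1 s with h1 | h1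
  · refine le_trans ?_ h1
    simpa using l2_opNorm_mul_le (l2_opNorm_one_sub_le hW) (l2_opNorm_le_one_of_isometry hV)
  have hc : 0 < 1 - s ^ 2 := by nlinarith
  set M : Matrix κ κ ℝ := Vᵀ * W with hM
  -- Pythagoras turns the sine bound into a lower bound on the cosines. As M is square, it is then
  -- invertible, and the same lower bound must be transferred to Mᵀ.
  have hlow : ∀ z, (1 - s ^ 2) * (z ⬝ᵥ z) ≤ (M *ᵥ z) ⬝ᵥ (M *ᵥ z) := by
    intro z
    have h2 := mulVec_dotProduct_self_le ((1 - V * Vᵀ) * W) z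
    rw [← Matrix.mulVec_mulVec, one_sub_mulVec_dotProduct_self hV,
      mulVec_dotProduct_mulVec_of_isometry hW, Matrix.mulVec_mulVec] at h2
    have h3 : ‖(1 - V * Vᵀ) * W‖ ^ 2 * (z ⬝ᵥ z) ≤ s ^ 2 * (z ⬝ᵥ z) :=
      mul_le_mul_of_nonneg_right (pow_le_pow_left₀ (norm_nonneg _) h 2)
        (dotProduct_self_nonneg' z)
    linarith
  have hinj : Function.Injective M.mulVec := by
    refine (injective_iff_map_eq_zero M.mulVecLin).2 fun z hz => ?_
    have h2 := hlow z
    rw [show M *ᵥ z = 0 from hz, dotProduct_zero] at h2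
    have h3 : z ⬝ᵥ z = 0 :=
      le_antisymm (by nlinarith [dotProduct_self_nonneg' z]) (dotProduct_self_nonneg' z)
    exact dotProduct_self_eq_zero.1 h3
  have hunit : IsUnit M := Matrix.mulVec_injective_iff_isUnit.1 hinj
  have hsurj : Function.Surjective M.mulVec := Matrix.mulVec_surjective_iff_isUnit.2 hunit
  refine l2_opNorm_le_of_forall _ hs fun z => ?_
  rw [← Matrix.mulVec_mulVec, one_sub_mulVec_dotProduct_self hW,
    mulVec_dotProduct_mulVec_of_isometry hV, Matrix.mulVec_mulVec,
    show Wᵀ * V = Mᵀ by rw [hM, Matrix.transpose_mul, Matrix.transpose_transpose]]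
  obtain ⟨w, hw⟩ := hsurj z
  -- With z = Mw, Cauchy–Schwarz against w and the lower bound for M at w give the lower bound for
  -- Mᵀ at z.
  have h2 : z ⬝ᵥ z = (Mᵀ *ᵥ z) ⬝ᵥ w := by
    conv_lhs => rw [← hw]
    rw [dotProduct_comm, Matrix.dotProduct_mulVec, ← Matrix.mulVec_transpose, hw]
  have h3 := hlow w
  rw [show M *ᵥ w = z from hw] at h3
  have hcs : ((Mᵀ *ᵥ z) ⬝ᵥ w) ^ 2 ≤ ((Mᵀ *ᵥ z) ⬝ᵥ (Mᵀ *ᵥ z)) * (w ⬝ᵥ w) := by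
    simpa [dotProduct, sq] using Finset.sum_mul_sq_le_sq_mul_sq Finset.univ (Mᵀ *ᵥ z) w
  have hz := dotProduct_self_nonneg' z
  have hMz := dotProduct_self_nonneg' (Mᵀ *ᵥ z)
  rw [← h2] at hcs
  rcases hz.eq_or_lt with h0 | h0
  · rw [← h0]; linarith
  have h4 : (z ⬝ᵥ z) * ((1 - s ^ 2) * (z ⬝ᵥ z)) ≤ (z ⬝ᵥ z) * ((Mᵀ *ᵥ z) ⬝ᵥ (Mᵀ *ᵥ z)) := by
    nlinarith [mul_le_mul_of_nonneg_left h3 hMz, mul_le_mul_of_nonneg_left hcs hc.le]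
  linarith [le_of_mul_le_mul_left h4 h0]

open Matrix

/-! ### Residual identities and the sin-theta estimate -/

section Residual

variable {μ ν ι κ : Type*} [Fintype μ] [Fintype ν] [Fintype ι] [Fintype κ]
  [DecidableEq μ] [DecidableEq ν] [DecidableEq ι] [DecidableEq κ]

/-- `A` is `U diag(σ) Vᵀ` with `U` and `V` isometries. -/
structure IsFactorization (A : Matrix μ ν ℝ) (U : Matrix μ ι ℝ) (σ : ι → ℝ) (V : Matrix ν ι ℝ) :
    Prop where
  left : Uᵀ * U = 1
  right : Vᵀ * V = 1
  eq : A = U * diagonal σ * Vᵀ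

/-- The columns of `U` and `V` are left and right singular vectors of `B`, with values `τ`. -/
structure IsSingularFamily (B : Matrix μ ν ℝ) (U : Matrix μ κ ℝ) (τ : κ → ℝ) (V : Matrix ν κ ℝ) :
    Prop where
  left : Uᵀ * U = 1
  right : Vᵀ * V = 1
  mul_right : B * V = U * diagonal τ
  transpose_mul_left : Bᵀ * U = V * diagonal τ

variable {A B E : Matrix μ ν ℝ} {U : Matrix μ ι ℝ} {V : Matrix ν ι ℝ} {σ : ι → ℝ}
  {U' : Matrix μ κ ℝ} {V' : Matrix ν κ ℝ} {τ : κ → ℝ} {t e : ℝ}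

lemma IsFactorization.transpose (h : IsFactorization A U σ V) : IsFactorization Aᵀ V σ U :=
  ⟨h.right, h.left, by rw [h.eq]; simp [Matrix.mul_assoc]⟩

lemma IsSingularFamily.transpose (h : IsSingularFamily B U' τ V') :
    IsSingularFamily Bᵀ V' τ U' :=
  ⟨h.right, h.left, h.transpose_mul_left, by rw [transpose_transpose, h.mul_right]⟩

lemma IsFactorization.mul_one_sub (h : IsFactorization A U σ V) : A * (1 - V * Vᵀ) = 0 := by
  rw [h.eq, Matrix.mul_sub, Matrix.mul_one, Matrix.mul_assoc _ Vᵀ, ← Matrix.mul_assoc Vᵀ, h.right,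
    Matrix.one_mul, sub_self]

lemma IsFactorization.left_transpose_mul (h : IsFactorization A U σ V) : Uᵀ * A = diagonal σ * Vᵀ := by
  rw [h.eq, ← Matrix.mul_assoc, ← Matrix.mul_assoc, h.left, Matrix.one_mul]

lemma diagonal_mul_diagonal_inv (hτ : ∀ k, t ≤ τ k) (ht : 0 < t) :
    diagonal τ * diagonal τ⁻¹ = 1 := by
  rw [diagonal_mul_diagonal, ← diagonal_one]
  congr 1
  ext k
  exact mul_inv_cancel₀ (ht.trans_le (hτ k)).ne'

lemma l2_opNorm_diagonal_inv_le (hτ : ∀ k, t ≤ τ k) (ht : 0 < t) :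
    ‖diagonal τ⁻¹‖ ≤ t⁻¹ :=
  l2_opNorm_diagonal_le (by positivity) fun k => by
    have := ht.trans_le (hτ k)
    rw [Pi.inv_apply, abs_of_pos (by positivity)]
    exact inv_anti₀ ht (hτ k)

/-- Since V' = (A + E)ᵀ U' diag(τ)⁻¹ and the projection kills Aᵀ, only the contribution of E
remains. -/
lemma IsFactorization.one_sub_mul_singular (hA : IsFactorization A U σ V)
    (hB : IsSingularFamily (A + E) U' τ V') (hτ : ∀ k, t ≤ τ k) (ht : 0 < t) :
    (1 - V * Vᵀ) * V' = (1 - V * Vᵀ) * Eᵀ * U' * diagonal τ⁻¹ := by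
  have h0 : (1 - V * Vᵀ) * Aᵀ = 0 := by
    have := congrArg Matrix.transpose hA.mul_one_sub
    simpa using this
  have h1 : V' = (A + E)ᵀ * U' * diagonal τ⁻¹ := by
    rw [hB.transpose_mul_left, Matrix.mul_assoc, diagonal_mul_diagonal_inv hτ ht, Matrix.mul_one]
  conv_lhs => rw [h1]
  rw [← Matrix.mul_assoc, ← Matrix.mul_assoc, transpose_add, Matrix.mul_add, h0, zero_add]

lemma IsFactorization.norm_one_sub_mul_singular_le (hA : IsFactorization A U σ V)
    (hB : IsSingularFamily (A + E) U' τ V') (hτ : ∀ k, t ≤ τ k) (ht : 0 < t) (he : ‖E‖ ≤ e) :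
    ‖(1 - V * Vᵀ) * V'‖ ≤ e * t⁻¹ := by
  rw [hA.one_sub_mul_singular hB hτ ht]
  have := l2_opNorm_mul_le (l2_opNorm_mul_le (l2_opNorm_mul_le (l2_opNorm_one_sub_le hA.right)
    ((l2_opNorm_transpose E).trans_le he)) (l2_opNorm_le_one_of_isometry hB.left))
    (l2_opNorm_diagonal_inv_le hτ ht)
  simpa using this

lemma diag_transpose_mul_self_le {M : Matrix μ ι ℝ} (hM : ‖M‖ ≤ e) (j : ι) :
    |(Mᵀ * M) j j| ≤ e ^ 2 := by
  have h := mulVec_dotProduct_self_le M (Pi.single j 1)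
  rw [mulVec_single_one] at h
  have h2 : (Mᵀ * M) j j = M.col j ⬝ᵥ M.col j := rfl
  have h3 := pow_le_pow_left₀ (norm_nonneg _) hM 2
  rw [h2, abs_of_nonneg (dotProduct_self_nonneg' _)]
  simp at h
  linarith

/-- The interaction `Uᵀ E V'` of the perturbation with the perturbed singular vectors, in terms of
the entries of `Uᵀ E V` and the off-diagonal entries of `Uᵀ E Eᵀ U`. -/
lemma frob_mask_mul_le (hA : IsFactorization A U σ V)
    (hB : IsSingularFamily (A + E) U' τ V') (hτ : ∀ k, t ≤ τ k) (ht : 0 < t)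
    (he : ‖E‖ ≤ e) (het : e ≤ t) {q : ι → ℝ} (hq : ∀ j, |q j| ≤ 1) {X Y : ℝ}
    (hX : frob (Uᵀ * E * V) ≤ X)
    (hY : frob (Uᵀ * E * Eᵀ * U - diagonal (fun j => (Uᵀ * E * Eᵀ * U) j j)) ≤ Y) :
    frob (diagonal q * (Uᵀ * E * V')) ≤
      2 * X + (Y + e ^ 2 * frob (diagonal q * (Uᵀ * U'))) * t⁻¹
        + √(Fintype.card κ) * (e ^ 3 * t⁻¹ ^ 2) := by
  have he0 : 0 ≤ e := (norm_nonneg E).trans he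
  have hX0 : 0 ≤ X := (frob_nonneg _).trans hX
  have hY0 : 0 ≤ Y := (frob_nonneg _).trans hY
  set R : Matrix κ κ ℝ := diagonal τ⁻¹
  set Q : Matrix ι ι ℝ := diagonal q
  set g : ι → ℝ := fun j => (Uᵀ * E * Eᵀ * U) j j
  set Y₀ := Uᵀ * E * Eᵀ * U - diagonal g with hY₀
  have hR : ‖R‖ ≤ t⁻¹ := l2_opNorm_diagonal_inv_le hτ ht
  have hQ : ‖Q‖ ≤ 1 := l2_opNorm_diagonal_le zero_le_one hq
  have hU := l2_opNorm_le_one_of_isometry hA.left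
  have hV := l2_opNorm_le_one_of_isometry hA.right
  have hU' := l2_opNorm_le_one_of_isometry hB.left
  have hV' := l2_opNorm_le_one_of_isometry hB.right
  have hUt := (l2_opNorm_transpose U).trans_le hU
  have hVt := (l2_opNorm_transpose V).trans_le hV
  have hEt := (l2_opNorm_transpose E).trans_le he
  have hg : ∀ j, |g j| ≤ e ^ 2 := by
    intro j
    have h1 : ‖Eᵀ * U‖ ≤ e := by simpa using l2_opNorm_mul_le hEt hU
    have h2 := diag_transpose_mul_self_le h1 j
    rw [transpose_mul, transpose_transpose, ← Matrix.mul_assoc] at h2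
    exact h2
  have hperp := hA.one_sub_mul_singular hB hτ ht
  have hperp' := hA.transpose.one_sub_mul_singular (E := Eᵀ)
    (by rw [← transpose_add]; exact hB.transpose) hτ ht
  rw [transpose_transpose] at hperp'
  have hQg : Q * diagonal g = diagonal g * Q := by
    simp only [Q, diagonal_mul_diagonal, mul_comm]
  -- Split V' along V and its complement, replace the complement by its residual formula, then split
  -- the resulting U' along U in the same way.
  have key : Q * (Uᵀ * E * V') = Q * (Uᵀ * E * V) * (Vᵀ * V')
      + (Q * Y₀ * (Uᵀ * U') + diagonal g * (Q * (Uᵀ * U'))) * R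
      + Q * Uᵀ * E * Eᵀ * ((1 - U * Uᵀ) * E * V' * R) * R
      - Q * (Uᵀ * E * V) * (Vᵀ * Eᵀ * U') * R := by
    have e1 : V' = V * (Vᵀ * V') + (1 - V * Vᵀ) * V' := by
      rw [Matrix.sub_mul, Matrix.one_mul, Matrix.mul_assoc]; abel
    have e2 : U' = U * (Uᵀ * U') + (1 - U * Uᵀ) * U' := by
      rw [Matrix.sub_mul, Matrix.one_mul, Matrix.mul_assoc]; abel
    have e3 : Q * (Uᵀ * E * V') = Q * (Uᵀ * E * V) * (Vᵀ * V')
        + Q * Uᵀ * E * ((1 - V * Vᵀ) * V') := by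
      conv_lhs => rw [e1]
      simp only [Matrix.mul_add, Matrix.mul_assoc]
    have e4 : Q * Uᵀ * E * ((1 - V * Vᵀ) * V') =
        Q * Uᵀ * E * Eᵀ * U' * R - Q * (Uᵀ * E * V) * (Vᵀ * Eᵀ * U') * R := by
      rw [hperp, show diagonal τ⁻¹ = R from rfl]
      simp only [Matrix.mul_sub, Matrix.sub_mul, Matrix.one_mul, Matrix.mul_assoc]
    have e5 : Q * Uᵀ * E * Eᵀ * U' = (Q * Y₀ * (Uᵀ * U') + diagonal g * (Q * (Uᵀ * U')))
        + Q * Uᵀ * E * Eᵀ * ((1 - U * Uᵀ) * E * V' * R) := by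
      rw [← hperp', ← Matrix.mul_assoc (diagonal g), ← hQg, ← Matrix.add_mul, ← Matrix.mul_add, hY₀,
        sub_add_cancel]
      conv_lhs => rw [e2]
      simp only [Matrix.mul_add, Matrix.mul_assoc]
    rw [e3, e4, e5, Matrix.add_mul _ _ R]
    abel
  have hc : ‖Vᵀ * V'‖ ≤ 1 := by simpa using l2_opNorm_mul_le hVt hV'
  have ha : ‖Uᵀ * U'‖ ≤ 1 := by simpa using l2_opNorm_mul_le hUt hU'
  have hQX : frob (Q * (Uᵀ * E * V)) ≤ X :=
    (frob_mul_le _ _).trans (by simpa using mul_le_mul hQ hX (frob_nonneg _) zero_le_one)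
  have b1 : frob (Q * (Uᵀ * E * V) * (Vᵀ * V')) ≤ X :=
    (frob_mul_le' _ _).trans (by simpa using mul_le_mul hQX hc (norm_nonneg _) hX0)
  have b2 : frob (Q * (Uᵀ * E * V) * (Vᵀ * Eᵀ * U') * R) ≤ X := by
    have h1 : ‖Vᵀ * Eᵀ * U' * R‖ ≤ e * t⁻¹ := by
      simpa using l2_opNorm_mul_le (l2_opNorm_mul_le (l2_opNorm_mul_le hVt hEt) hU') hR
    have h2 : e * t⁻¹ ≤ 1 := by rw [← div_eq_mul_inv]; exact (div_le_one ht).2 het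
    rw [Matrix.mul_assoc]
    exact (frob_mul_le' _ _).trans
      (by simpa using mul_le_mul hQX (h1.trans h2) (norm_nonneg _) hX0)
  have b3 : frob (Q * Y₀ * (Uᵀ * U')) ≤ Y := by
    have h1 : frob (Q * Y₀) ≤ Y :=
      (frob_mul_le _ _).trans (by simpa using mul_le_mul hQ hY (frob_nonneg _) zero_le_one)
    exact (frob_mul_le' _ _).trans (by simpa using mul_le_mul h1 ha (norm_nonneg _) hY0)
  have b4 : frob (diagonal g * (Q * (Uᵀ * U'))) ≤ e ^ 2 * frob (Q * (Uᵀ * U')) :=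
    (frob_mul_le _ _).trans
      (mul_le_mul_of_nonneg_right (l2_opNorm_diagonal_le (by positivity) hg) (frob_nonneg _))
  have b5 : frob ((Q * Y₀ * (Uᵀ * U') + diagonal g * (Q * (Uᵀ * U'))) * R) ≤
      (Y + e ^ 2 * frob (Q * (Uᵀ * U'))) * t⁻¹ :=
    (frob_mul_le' _ _).trans (mul_le_mul ((frob_add_le _ _).trans (add_le_add b3 b4)) hR
      (norm_nonneg _) (by have := frob_nonneg (Q * (Uᵀ * U')); positivity))
  have b6 : frob (Q * Uᵀ * E * Eᵀ * ((1 - U * Uᵀ) * E * V' * R) * R) ≤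
      √(Fintype.card κ) * (e ^ 3 * t⁻¹ ^ 2) := by
    refine (frob_le_sqrt_card_mul _).trans (mul_le_mul_of_nonneg_left ?_ (Real.sqrt_nonneg _))
    refine (l2_opNorm_mul_le (l2_opNorm_mul_le
      (l2_opNorm_mul_le (l2_opNorm_mul_le (l2_opNorm_mul_le hQ hUt) he) hEt)
      (l2_opNorm_mul_le (l2_opNorm_mul_le (l2_opNorm_mul_le (l2_opNorm_one_sub_le hA.left) he)
        hV') hR)) hR).trans (le_of_eq ?_)
    ring
  rw [key]
  have := frob_sub_le (Q * (Uᵀ * E * V) * (Vᵀ * V')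
      + (Q * Y₀ * (Uᵀ * U') + diagonal g * (Q * (Uᵀ * U'))) * R
      + Q * Uᵀ * E * Eᵀ * ((1 - U * Uᵀ) * E * V' * R) * R)
      (Q * (Uᵀ * E * V) * (Vᵀ * Eᵀ * U') * R)
  have h2 := frob_add_le (Q * (Uᵀ * E * V) * (Vᵀ * V')
      + (Q * Y₀ * (Uᵀ * U') + diagonal g * (Q * (Uᵀ * U'))) * R)
      (Q * Uᵀ * E * Eᵀ * ((1 - U * Uᵀ) * E * V' * R) * R)
  have h3 := frob_add_le (Q * (Uᵀ * E * V) * (Vᵀ * V'))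
      ((Q * Y₀ * (Uᵀ * U') + diagonal g * (Q * (Uᵀ * U'))) * R)
  linarith

/-- A sin-theta bound in terms of the skewness of the perturbation: `q` selects singular vectors of
`A` whose singular values are below those of the family `U', τ, V'`. -/
lemma exists_frob_mask_le (hA : IsFactorization A U σ V)
    (hB : IsSingularFamily (A + E) U' τ V') (hτ : ∀ k, t ≤ τ k) (ht : 0 < t)
    (he : ‖E‖ ≤ e) (het : e ≤ t) {q : ι → ℝ} (hq : ∀ j, q j = 0 ∨ q j = 1) {X Y d : ℝ}
    (hσ : ∀ j, 0 ≤ σ j) (hd : ∀ j k, q j = 1 → d ≤ τ k - σ j) (hd0 : 0 ≤ d)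
    (hX : frob (Uᵀ * E * V) ≤ X)
    (hY : frob (Uᵀ * E * Eᵀ * U - diagonal (fun j => (Uᵀ * E * Eᵀ * U) j j)) ≤ Y)
    (hY' : frob (Vᵀ * Eᵀ * E * V - diagonal (fun j => (Vᵀ * Eᵀ * E * V) j j)) ≤ Y) :
    ∃ T, frob (diagonal q * (Uᵀ * U')) ≤ T ∧ frob (diagonal q * (Vᵀ * V')) ≤ T ∧
      d * T ≤ 4 * X + 2 * (Y + e ^ 2 * T) * t⁻¹
        + 2 * (√(Fintype.card κ) * (e ^ 3 * t⁻¹ ^ 2)) := by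
  have hq1 : ∀ j, |q j| ≤ 1 := fun j => by rcases hq j with h | h <;> simp [h]
  have hBt : IsSingularFamily (Aᵀ + Eᵀ) V' τ U' := by rw [← transpose_add]; exact hB.transpose
  have hF1 := frob_mask_mul_le hA hB hτ ht he het hq1 hX hY
  have hF2 := frob_mask_mul_le hA.transpose hBt hτ ht ((l2_opNorm_transpose E).trans_le he) het hq1
    (X := X) (Y := Y)
    (by rw [← frob_transpose]; simpa [Matrix.mul_assoc] using hX)
    (by rw [transpose_transpose]; exact hY')
  set a := Uᵀ * U'
  set c := Vᵀ * V'
  set F1 := Uᵀ * E * V'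
  set F2 := Vᵀ * Eᵀ * U'
  have e1 : a * diagonal τ = diagonal σ * c + F1 := by
    simp only [a, c, F1]
    rw [Matrix.mul_assoc, ← hB.mul_right, ← Matrix.mul_assoc, Matrix.mul_add, hA.left_transpose_mul,
      Matrix.add_mul, Matrix.mul_assoc (diagonal σ)]
  have e2 : c * diagonal τ = diagonal σ * a + F2 := by
    simp only [a, c, F2]
    rw [Matrix.mul_assoc, ← hBt.mul_right, ← Matrix.mul_assoc, Matrix.mul_add,
      hA.transpose.left_transpose_mul, Matrix.add_mul, Matrix.mul_assoc (diagonal σ)]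
  -- The two equations couple a and c; summing absolute values decouples them, leaving the factor
  -- τ_k - σ_j.
  set W : Matrix ι κ ℝ := (diagonal q * a).map abs + (diagonal q * c).map abs
  have ha : frob (diagonal q * a) ≤ frob W := frob_le_frob fun j k => by
    simp [W, mul_nonneg]
  have hc : frob (diagonal q * c) ≤ frob W := frob_le_frob fun j k => by
    simp [W, mul_nonneg]
  refine ⟨frob W, ha, hc, ?_⟩
  have hW : d * frob W ≤ frob (diagonal q * F1) + frob (diagonal q * F2) := by
    rw [← frob_smul hd0, ← frob_abs (diagonal q * F1), ← frob_abs (diagonal q * F2)]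
    refine (frob_le_frob fun j k => ?_).trans (frob_add_le _ _)
    have e1' := congrFun (congrFun e1 j) k
    have e2' := congrFun (congrFun e2 j) k
    simp only [mul_diagonal, diagonal_mul, Matrix.add_apply] at e1' e2'
    simp only [W, Matrix.smul_apply, Matrix.add_apply, Matrix.map_apply, diagonal_mul, smul_eq_mul]
    rw [abs_of_nonneg (by positivity)]
    rcases hq j with h | h
    · simp [h]
    · rw [h]
      simp only [one_mul]
      have h1 : τ k * |a j k| ≤ σ j * |c j k| + |F1 j k| := by
        have := abs_add_le (σ j * c j k) (F1 j k)
        rw [← e1', abs_mul, abs_mul, abs_of_nonneg (hσ j),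
          abs_of_pos (ht.trans_le (hτ k))] at this
        linarith
      have h2 : τ k * |c j k| ≤ σ j * |a j k| + |F2 j k| := by
        have := abs_add_le (σ j * a j k) (F2 j k)
        rw [← e2', abs_mul, abs_mul, abs_of_nonneg (hσ j),
          abs_of_pos (ht.trans_le (hτ k))] at this
        linarith
      have h3 := mul_le_mul_of_nonneg_right (hd j k h)
        (add_nonneg (abs_nonneg (a j k)) (abs_nonneg (c j k)))
      linarith
  have hmul : ∀ s, s ≤ frob W → (Y + e ^ 2 * s) * t⁻¹ ≤ (Y + e ^ 2 * frob W) * t⁻¹ := by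
    intro s hs
    gcongr
  have := hmul _ ha
  have := hmul _ hc
  linarith

/-- The difference of truncations is controlled by the sines of the angles. -/
lemma norm_truncation_sub_le (hA : IsFactorization A U σ V)
    (hB : IsSingularFamily (A + E) U' τ V') (hτ : ∀ k, t ≤ τ k) (ht : 0 < t)
    (he : ‖E‖ ≤ e) {q : ι → ℝ} (hq : ∀ j, q j = 0 ∨ q j = 1) {s ρ T : ℝ}
    (hs : ∀ j, |q j * σ j| ≤ s) (hs0 : 0 ≤ s)
    {Vp : Matrix ν κ ℝ} (hVp : Vpᵀ * Vp = 1)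
    (hP : Vp * Vpᵀ = V * (1 - diagonal q) * Vᵀ)
    (hρ : ‖A + E - U' * diagonal τ * V'ᵀ‖ ≤ ρ)
    (hT1 : frob (diagonal q * (Uᵀ * U')) ≤ T) (hT2 : frob (diagonal q * (Vᵀ * V')) ≤ T) :
    ‖U' * diagonal τ * V'ᵀ - U * ((1 - diagonal q) * diagonal σ) * Vᵀ‖ ≤
      2 * e + s * T + ρ * (e * t⁻¹ + T) := by
  have hρ0 : 0 ≤ ρ := (norm_nonneg _).trans hρ
  have hT0 : 0 ≤ T := (frob_nonneg _).trans hT1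
  set Q : Matrix ι ι ℝ := diagonal q
  set P := Vp * Vpᵀ
  set Bp := U' * diagonal τ * V'ᵀ with hBp
  set N := A + E - Bp with hN
  have hQQ : Q * Q = Q := by
    simp only [Q, diagonal_mul_diagonal]
    congr 1; ext j; rcases hq j with h | h <;> simp [h]
  have hV := l2_opNorm_le_one_of_isometry hA.right
  have hU' := l2_opNorm_le_one_of_isometry hB.left
  have hVp' := l2_opNorm_le_one_of_isometry hVp
  have hVt := (l2_opNorm_transpose V).trans_le hV
  have hUt' := (l2_opNorm_transpose U').trans_le hU'
  have hPn : ‖P‖ ≤ 1 := by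
    simpa using l2_opNorm_mul_le hVp' ((l2_opNorm_transpose Vp).trans_le hVp')
  have hAP : A * P = U * ((1 - Q) * diagonal σ) * Vᵀ := by
    have hcomm : diagonal σ * (1 - Q) = (1 - Q) * diagonal σ := by
      simp only [Q, ← diagonal_one, diagonal_sub, diagonal_mul_diagonal, mul_comm]
    rw [hP, hA.eq, ← hcomm]
    simp only [Matrix.mul_assoc]
    rw [← Matrix.mul_assoc Vᵀ V, hA.right, Matrix.one_mul]
  have hNV : N * V' = 0 := by
    rw [hN, Matrix.sub_mul, hB.mul_right, hBp, Matrix.mul_assoc, hB.right, Matrix.mul_one, sub_self]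
  have hUB : U'ᵀ * (A + E) = diagonal τ * V'ᵀ := by
    have := congrArg Matrix.transpose hB.transpose_mul_left
    simpa using this
  have hBp2 : Bp = U' * (U'ᵀ * (A + E)) := by rw [hUB, hBp, Matrix.mul_assoc]
  -- With A P the truncation of A, this is Bp - AP = Bp(1 - P) - NP + EP. Since N V' = 0, the factor
  -- 1 - V'V'ᵀ may be inserted in NP, which makes that term small.
  have hsplit : Bp - U * ((1 - Q) * diagonal σ) * Vᵀ =
      U' * ((Q * (Uᵀ * U'))ᵀ * (Q * diagonal σ) * Vᵀ) + U' * U'ᵀ * E * (1 - P)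
        - N * ((1 - V' * V'ᵀ) * Vp) * Vpᵀ + E * P := by
    have e1 : N * ((1 - V' * V'ᵀ) * Vp) * Vpᵀ = N * P := by
      rw [← Matrix.mul_assoc, Matrix.mul_sub, ← Matrix.mul_assoc N, hNV]
      simp [P, Matrix.mul_assoc]
    have e2 : Uᵀᵀ * (Q * diagonal σ) * Vᵀ = A - A * P := by
      rw [hAP, hA.eq, Matrix.sub_mul, Matrix.one_mul, Matrix.mul_sub, Matrix.sub_mul,
        transpose_transpose, sub_sub_cancel]
    have e3 : (Q * (Uᵀ * U'))ᵀ * (Q * diagonal σ) * Vᵀ = U'ᵀ * (A - A * P) := by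
      rw [← e2]
      simp only [transpose_mul, transpose_transpose]
      have : Qᵀ = Q := diagonal_transpose q
      rw [this]
      simp only [Matrix.mul_assoc]
      rw [← Matrix.mul_assoc Q Q, hQQ]
    rw [e1, e3, ← hAP]
    have e4 : U' * (U'ᵀ * (A - A * P)) + U' * U'ᵀ * E * (1 - P) = Bp * (1 - P) := by
      rw [hBp2]
      simp only [Matrix.mul_assoc, Matrix.mul_sub, Matrix.mul_add, Matrix.add_mul, Matrix.mul_one]
      abel
    rw [e4, hN, Matrix.sub_mul, Matrix.add_mul, Matrix.mul_sub, Matrix.mul_one]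
    abel
  -- The available estimates concern V' outside the span of `Vp`; equal ranks let the two subspaces
  -- be exchanged.
  have hsin : ‖(1 - V' * V'ᵀ) * Vp‖ ≤ e * t⁻¹ + T := by
    refine l2_opNorm_one_sub_mul_le_symm hVp hB.right ?_
    have e1 : (1 - Vp * Vpᵀ) * V' = (1 - V * Vᵀ) * V' + V * (Q * (Vᵀ * V')) := by
      rw [show Vp * Vpᵀ = V * (1 - Q) * Vᵀ from hP]
      simp only [Matrix.mul_sub, Matrix.sub_mul, Matrix.mul_one, Matrix.one_mul, Matrix.mul_assoc]
      abel
    rw [e1]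
    refine (norm_add_le _ _).trans (add_le_add ?_ ?_)
    · exact hA.norm_one_sub_mul_singular_le hB hτ ht he
    · simpa using l2_opNorm_mul_le hV ((l2_opNorm_le_frob _).trans hT2)
  have b1 : ‖U' * ((Q * (Uᵀ * U'))ᵀ * (Q * diagonal σ) * Vᵀ)‖ ≤ s * T := by
    have h1 : ‖Q * diagonal σ‖ ≤ s := by
      rw [diagonal_mul_diagonal]
      exact l2_opNorm_diagonal_le hs0 hs
    have h2 : ‖(Q * (Uᵀ * U'))ᵀ‖ ≤ T :=
      (l2_opNorm_transpose _).trans_le ((l2_opNorm_le_frob _).trans hT1)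
    simpa [mul_comm] using l2_opNorm_mul_le hU' (l2_opNorm_mul_le (l2_opNorm_mul_le h2 h1) hVt)
  have b2 : ‖U' * U'ᵀ * E * (1 - P)‖ ≤ e := by
    simpa using l2_opNorm_mul_le (l2_opNorm_mul_le (l2_opNorm_mul_le hU' hUt') he)
      (l2_opNorm_one_sub_le hVp)
  have b3 : ‖N * ((1 - V' * V'ᵀ) * Vp) * Vpᵀ‖ ≤ ρ * (e * t⁻¹ + T) := by
    simpa using l2_opNorm_mul_le (l2_opNorm_mul_le hρ hsin)
      ((l2_opNorm_transpose Vp).trans_le hVp')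
  have b4 : ‖E * P‖ ≤ e := by simpa using l2_opNorm_mul_le he hPn
  rw [hsplit]
  have h1 := norm_add_le (U' * ((Q * (Uᵀ * U'))ᵀ * (Q * diagonal σ) * Vᵀ)
    + U' * U'ᵀ * E * (1 - P) - N * ((1 - V' * V'ᵀ) * Vp) * Vpᵀ) (E * P)
  have h2 := norm_sub_le (U' * ((Q * (Uᵀ * U'))ᵀ * (Q * diagonal σ) * Vᵀ)
    + U' * U'ᵀ * E * (1 - P)) (N * ((1 - V' * V'ᵀ) * Vp) * Vpᵀ)
  have h3 := norm_add_le (U' * ((Q * (Uᵀ * U'))ᵀ * (Q * diagonal σ) * Vᵀ))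
    (U' * U'ᵀ * E * (1 - P))
  linarith

end Residual

/-! ### Restriction to the leading singular triples -/

section Selection

variable {p k m n : ℕ}

/-- The isometry onto the first `p` coordinates. -/
noncomputable def select (h : p ≤ k) : Matrix (Fin k) (Fin p) ℝ :=
  (1 : Matrix (Fin k) (Fin k) ℝ).submatrix id (Fin.castLE h)

/-- The indicator of the coordinates from `p` on. -/
noncomputable def tailMask (k p : ℕ) : Fin k → ℝ := fun j => if (j : ℕ) < p then 0 else 1

lemma transpose_select_mul_apply (h : p ≤ k) (M : Matrix (Fin k) (Fin m) ℝ) (i : Fin p)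
    (j : Fin m) : ((select h)ᵀ * M) i j = M (Fin.castLE h i) j := by
  simp [select, Matrix.mul_apply, Matrix.one_apply]

lemma select_transpose_mul (h : p ≤ k) : (select h)ᵀ * select h = 1 := by
  ext i j
  rw [transpose_select_mul_apply]
  simp [select, Matrix.one_apply, Fin.ext_iff]

lemma select_mul_transpose (h : p ≤ k) :
    select h * (select h)ᵀ = 1 - diagonal (tailMask k p) := by
  ext i j
  simp only [select, Matrix.mul_apply, transpose_apply, submatrix_apply, id, Matrix.one_apply,
    Matrix.sub_apply, diagonal_apply, tailMask]
  by_cases hi : (i : ℕ) < p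
  · rw [Finset.sum_eq_single ⟨i, hi⟩]
    · simp [hi, Fin.ext_iff, eq_comm]
    · intro b _ hb
      have : i ≠ Fin.castLE h b := fun h2 => hb (by ext; simp [h2])
      simp [this]
    · simp
  · rw [Finset.sum_eq_zero]
    · split_ifs <;> simp
    · intro b _
      have : i ≠ Fin.castLE h b := fun h2 => hi (by rw [h2]; exact b.2)
      simp [this]

lemma diagonal_mul_select (h : p ≤ k) (τ : Fin k → ℝ) :
    diagonal τ * select h = select h * diagonal (fun i => τ (Fin.castLE h i)) := by
  ext i j
  simp only [select, diagonal_mul, mul_diagonal, submatrix_apply, id, Matrix.one_apply]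
  split_ifs with h1
  · rw [h1]; ring
  · simp

lemma mul_select_apply (h : p ≤ k) (M : Matrix (Fin m) (Fin k) ℝ) (i : Fin m) (j : Fin p) :
    (M * select h) i j = M i (Fin.castLE h j) := by
  simp [select, Matrix.mul_apply, Matrix.one_apply]

lemma isometry_mul_select (h : p ≤ k) {M : Matrix (Fin m) (Fin k) ℝ} (hM : Mᵀ * M = 1) :
    (M * select h)ᵀ * (M * select h) = 1 := by
  rw [transpose_mul, Matrix.mul_assoc, ← Matrix.mul_assoc Mᵀ, hM, Matrix.one_mul,
    select_transpose_mul]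

variable {B : Matrix (Fin m) (Fin n) ℝ} {U : Matrix (Fin m) (Fin k) ℝ}
  {V : Matrix (Fin n) (Fin k) ℝ} {τ : Fin k → ℝ}

lemma IsFactorization.mul_right_select (hB : IsFactorization B U τ V) (h : p ≤ k) :
    B * (V * select h) = U * select h * diagonal fun i => τ (Fin.castLE h i) := by
  rw [hB.eq, Matrix.mul_assoc, ← Matrix.mul_assoc Vᵀ, hB.right, Matrix.one_mul, Matrix.mul_assoc,
    diagonal_mul_select, Matrix.mul_assoc]

lemma IsFactorization.isSingularFamily (hB : IsFactorization B U τ V) (h : p ≤ k) :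
    IsSingularFamily B (U * select h) (fun i => τ (Fin.castLE h i)) (V * select h) :=
  ⟨isometry_mul_select h hB.left, isometry_mul_select h hB.right, hB.mul_right_select h,
    hB.transpose.mul_right_select h⟩

/-- The product of the first `p` singular triples. -/
lemma select_mul_diagonal_mul (h : p ≤ k) (U : Matrix (Fin m) (Fin k) ℝ)
    (V : Matrix (Fin n) (Fin k) ℝ) (τ : Fin k → ℝ) :
    U * select h * diagonal (fun i => τ (Fin.castLE h i)) * (V * select h)ᵀ =
      U * ((1 - diagonal (tailMask k p)) * diagonal τ) * Vᵀ := by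
  have hcomm : (1 - diagonal (tailMask k p)) * diagonal τ =
      diagonal τ * (1 - diagonal (tailMask k p)) := by
    simp only [← diagonal_one, diagonal_sub, diagonal_mul_diagonal, mul_comm]
  rw [hcomm, ← select_mul_transpose h, Matrix.mul_assoc U, ← diagonal_mul_select, transpose_mul]
  simp only [Matrix.mul_assoc]

end Selection

/-! ### Variational bounds for singular values -/

section MinMax

lemma norm_toLp_mulVec_le {ι κ : Type*} [Fintype ι] [Fintype κ] [DecidableEq κ]
    (M : Matrix ι κ ℝ) (z : κ → ℝ) :
    ‖WithLp.toLp 2 (M *ᵥ z)‖ ≤ ‖M‖ * ‖WithLp.toLp 2 z‖ :=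
  Matrix.l2_opNorm_mulVec M (WithLp.toLp 2 z)

lemma norm_toLp_mulVec_of_isometry {ι κ : Type*} [Fintype ι] [Fintype κ] [DecidableEq ι]
    [DecidableEq κ] {M : Matrix ι κ ℝ} (hM : Mᵀ * M = 1) (z : κ → ℝ) :
    ‖WithLp.toLp 2 (M *ᵥ z)‖ = ‖WithLp.toLp 2 z‖ := by
  rw [← sq_eq_sq₀ (norm_nonneg _) (norm_nonneg _), norm_toLp_sq, norm_toLp_sq,
    mulVec_dotProduct_mulVec_of_isometry hM]

lemma le_norm_toLp_diagonal_mulVec {κ : Type*} [Fintype κ] [DecidableEq κ] {τ : κ → ℝ} {c : ℝ}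
    (hc : 0 ≤ c) (hτ : ∀ i, c ≤ τ i) (z : κ → ℝ) :
    c * ‖WithLp.toLp 2 z‖ ≤ ‖WithLp.toLp 2 (diagonal τ *ᵥ z)‖ := by
  refine le_of_sq_le_sq ?_ (norm_nonneg _)
  rw [mul_pow, norm_toLp_sq, norm_toLp_sq, dotProduct, dotProduct, Finset.mul_sum]
  refine Finset.sum_le_sum fun i _ => ?_
  rw [mulVec_diagonal]
  have := mul_le_mul_of_nonneg_right (pow_le_pow_left₀ hc (hτ i) 2) (mul_self_nonneg (z i))
  linarith

variable {m n k k' : ℕ}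

/-- The variational lower bound for singular values. -/
lemma IsFactorization.le_of_forall_le_norm {B : Matrix (Fin m) (Fin n) ℝ}
    {U : Matrix (Fin m) (Fin k) ℝ} {V : Matrix (Fin n) (Fin k) ℝ} {s : ℕ → ℝ}
    (hB : IsFactorization B U (fun i => s i) V) (hs : Antitone s) (hs0 : ∀ i, 0 ≤ s i)
    {i : ℕ} {W : Matrix (Fin n) (Fin (i + 1)) ℝ} (hW : ‖W‖ ≤ 1) {c : ℝ}
    (h : ∀ z : Fin (i + 1) → ℝ, c * ‖WithLp.toLp 2 z‖ ≤ ‖WithLp.toLp 2 ((B * W) *ᵥ z)‖) :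
    c ≤ s i := by
  -- Dimension count: i equations in i + 1 unknowns have a nonzero solution, giving a vector with no
  -- component on the first i right singular vectors. The guard covers i > k.
  let G : Matrix (Fin i) (Fin (i + 1)) ℝ :=
    Matrix.of fun l j => if hl : (l : ℕ) < k then (Vᵀ * W) ⟨l, hl⟩ j else 0
  have hker : LinearMap.ker G.mulVecLin ≠ ⊥ :=
    LinearMap.ker_ne_bot_of_finrank_lt (by simp)
  obtain ⟨z, hz, hz0⟩ := Submodule.exists_mem_ne_zero_of_ne_bot hker
  set y := (Vᵀ * W) *ᵥ z with hy
  have hy0 : ∀ l : Fin k, (l : ℕ) < i → y l = 0 := by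
    intro l hl
    have h1 : (G *ᵥ z) ⟨l, hl⟩ = 0 := congrFun (show G *ᵥ z = 0 from hz) _
    simpa [G, hy, mulVec, dotProduct] using h1
  have hzpos : 0 < ‖WithLp.toLp 2 z‖ := by
    rw [norm_pos_iff]
    intro h0
    exact hz0 (congrArg WithLp.ofLp h0)
  have h1 : ‖WithLp.toLp 2 ((B * W) *ᵥ z)‖ ≤ s i * ‖WithLp.toLp 2 z‖ := by
    have e1 : (B * W) *ᵥ z = U *ᵥ (diagonal (fun l : Fin k => s l) *ᵥ y) := by
      rw [hy, mulVec_mulVec, mulVec_mulVec, hB.eq]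
      simp only [Matrix.mul_assoc]
    rw [e1, norm_toLp_mulVec_of_isometry hB.left]
    have e2 : ‖WithLp.toLp 2 (diagonal (fun l : Fin k => s l) *ᵥ y)‖ ≤
        s i * ‖WithLp.toLp 2 y‖ := by
      refine le_of_sq_le_sq ?_ (mul_nonneg (hs0 i) (norm_nonneg _))
      rw [mul_pow, norm_toLp_sq, norm_toLp_sq, dotProduct, dotProduct, Finset.mul_sum]
      refine Finset.sum_le_sum fun l _ => ?_
      rw [mulVec_diagonal]
      rcases lt_or_ge (l : ℕ) i with hl | hl
      · simp [hy0 l hl]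
      · have := mul_le_mul_of_nonneg_right (pow_le_pow_left₀ (hs0 l) (hs hl) 2)
          (mul_self_nonneg (y l))
        linarith
    refine e2.trans (mul_le_mul_of_nonneg_left ?_ (hs0 i))
    have hV := (l2_opNorm_transpose V).trans_le (l2_opNorm_le_one_of_isometry hB.right)
    have h2 : ‖Vᵀ * W‖ ≤ 1 := by simpa using l2_opNorm_mul_le hV hW
    exact (norm_toLp_mulVec_le _ _).trans
      ((mul_le_mul_of_nonneg_right h2 (norm_nonneg _)).trans_eq (one_mul _))
  exact le_of_mul_le_mul_right ((h z).trans h1) hzpos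

variable {A B : Matrix (Fin m) (Fin n) ℝ}
  {U : Matrix (Fin m) (Fin k) ℝ} {V : Matrix (Fin n) (Fin k) ℝ}
  {U' : Matrix (Fin m) (Fin k') ℝ} {V' : Matrix (Fin n) (Fin k') ℝ} {s s' : ℕ → ℝ}

/-- Weyl's inequality for singular values. -/
lemma IsFactorization.weyl (hA : IsFactorization A U (fun i => s i) V)
    (hs : Antitone s) (hs0 : ∀ i, 0 ≤ s i) (hB : IsFactorization B U' (fun i => s' i) V')
    (hs' : Antitone s') (hs'0 : ∀ i, 0 ≤ s' i) (hzero : ∀ i, k' ≤ i → s' i = 0) (i : ℕ) :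
    s' i ≤ s i + ‖B - A‖ := by
  rcases le_or_gt k' i with hi | hi
  · rw [hzero i hi]
    exact add_nonneg (hs0 i) (norm_nonneg _)
  rw [← sub_le_iff_le_add]
  have hF := hB.isSingularFamily (p := i + 1) hi
  have hW := l2_opNorm_le_one_of_isometry hF.right
  refine hA.le_of_forall_le_norm hs hs0 hW fun z => ?_
  set W := V' * select (Nat.succ_le_of_lt hi)
  have h1 : s' i * ‖WithLp.toLp 2 z‖ ≤ ‖WithLp.toLp 2 ((B * W) *ᵥ z)‖ := by
    rw [hF.mul_right, ← mulVec_mulVec, norm_toLp_mulVec_of_isometry hF.left]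
    exact le_norm_toLp_diagonal_mulVec (hs'0 i)
      (fun j => hs' (by simpa using Nat.le_of_lt_succ j.2)) z
  have h2 : ‖WithLp.toLp 2 (((B - A) * W) *ᵥ z)‖ ≤ ‖B - A‖ * ‖WithLp.toLp 2 z‖ := by
    refine (norm_toLp_mulVec_le _ _).trans (mul_le_mul_of_nonneg_right ?_ (norm_nonneg _))
    simpa using l2_opNorm_mul_le (le_refl ‖B - A‖) hW
  have h3 : WithLp.toLp 2 ((B * W) *ᵥ z) =
      WithLp.toLp 2 ((A * W) *ᵥ z) + WithLp.toLp 2 (((B - A) * W) *ᵥ z) := by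
    rw [← WithLp.toLp_add, ← add_mulVec, ← Matrix.add_mul, add_sub_cancel]
  have h4 := norm_add_le (WithLp.toLp 2 ((A * W) *ᵥ z)) (WithLp.toLp 2 (((B - A) * W) *ᵥ z))
  rw [← h3] at h4
  linarith

/-- A lower bound for perturbed singular values in terms of the entries of `Uᵀ E V`. -/
lemma IsFactorization.sub_le_of_entries {E : Matrix (Fin m) (Fin n) ℝ}
    (hA : IsFactorization A U (fun i => s i) V) (hs : Antitone s) (hs0 : ∀ i, 0 ≤ s i)
    (hB : IsFactorization (A + E) U' (fun i => s' i) V')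
    (hs' : Antitone s') (hs'0 : ∀ i, 0 ≤ s' i) {x : ℝ} (hx0 : 0 ≤ x)
    (hx : ∀ i j, |(Uᵀ * E * V) i j| ≤ x) {i : ℕ} (hi : i + 1 ≤ k) :
    s i - (i + 1 : ℕ) * x ≤ s' i := by
  have hF := hA.isSingularFamily (p := i + 1) hi
  refine hB.le_of_forall_le_norm hs' hs'0 (l2_opNorm_le_one_of_isometry hF.right) fun z => ?_
  set W := V * select hi
  set L := U * select hi
  -- Compressing to the leading singular vectors of A on both sides leaves an (i + 1) × (i + 1)
  -- block of UᵀEV, so only x enters.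
  have hG : ‖Lᵀ * E * W‖ ≤ (i + 1 : ℕ) * x := by
    refine (l2_opNorm_le_frob _).trans ?_
    have := frob_le_of_forall_le (Lᵀ * E * W) hx0 fun a b => by
      have e1 : Lᵀ * E * W = (select hi)ᵀ * ((Uᵀ * E * V) * select hi) := by
        simp only [L, W, transpose_mul, Matrix.mul_assoc]
      have e2 : (Lᵀ * E * W) a b = (Uᵀ * E * V) (Fin.castLE hi a) (Fin.castLE hi b) := by
        rw [e1, transpose_select_mul_apply, mul_select_apply]
      rw [e2]
      exact hx _ _
    simpa using this
  have h1 : s i * ‖WithLp.toLp 2 z‖ ≤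
      ‖WithLp.toLp 2 (diagonal (fun j : Fin (i + 1) => s (Fin.castLE hi j : ℕ)) *ᵥ z)‖ :=
    le_norm_toLp_diagonal_mulVec (hs0 i)
      (fun j => hs (by simpa using Nat.le_of_lt_succ j.2)) z
  have h2 : ‖WithLp.toLp 2 ((Lᵀ * E * W) *ᵥ z)‖ ≤ (i + 1 : ℕ) * x * ‖WithLp.toLp 2 z‖ :=
    (norm_toLp_mulVec_le _ _).trans (mul_le_mul_of_nonneg_right hG (norm_nonneg _))
  have e3 : Lᵀ * ((A + E) * W) =
      diagonal (fun j : Fin (i + 1) => s (Fin.castLE hi j : ℕ)) + Lᵀ * E * W := by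
    rw [Matrix.add_mul, hF.mul_right, Matrix.mul_add, ← Matrix.mul_assoc, hF.left, Matrix.one_mul,
      Matrix.mul_assoc]
  have h3 : ‖WithLp.toLp 2 ((Lᵀ * ((A + E) * W)) *ᵥ z)‖ ≤
      ‖WithLp.toLp 2 (((A + E) * W) *ᵥ z)‖ := by
    rw [← mulVec_mulVec]
    refine (norm_toLp_mulVec_le _ _).trans (mul_le_of_le_one_left (norm_nonneg _) ?_)
    exact (l2_opNorm_transpose L).trans_le (l2_opNorm_le_one_of_isometry hF.left)
  rw [e3, add_mulVec, WithLp.toLp_add] at h3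
  have h4 := norm_sub_le_norm_add
    (WithLp.toLp 2 (diagonal (fun j : Fin (i + 1) => s (Fin.castLE hi j : ℕ)) *ᵥ z))
    (WithLp.toLp 2 ((Lᵀ * E * W) *ᵥ z))
  linarith

end MinMax

/-! ### Passage from singular systems to matrices, and final arithmetic -/

section Main

variable {m n k : ℕ}

/-- The matrix whose columns are the given vectors. -/
def colMatrix (u : Fin k → EuclideanSpace ℝ (Fin m)) : Matrix (Fin m) (Fin k) ℝ :=
  Matrix.of fun i j => (u j).ofLp i

lemma colMatrix_isometry {u : Fin k → EuclideanSpace ℝ (Fin m)} (hu : Orthonormal ℝ u) :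
    (colMatrix u)ᵀ * colMatrix u = 1 := by
  ext i j
  have := orthonormal_iff_ite.1 hu i j
  rw [Matrix.one_apply, ← this]
  simp [Matrix.mul_apply, colMatrix, PiLp.inner_apply, mul_comm]

lemma sum_smul_vecMulVec (u : Fin k → EuclideanSpace ℝ (Fin m))
    (v : Fin k → EuclideanSpace ℝ (Fin n)) (d : Fin k → ℝ) :
    ∑ i, d i • vecMulVec (u i).ofLp (v i).ofLp =
      colMatrix u * diagonal d * (colMatrix v)ᵀ := by
  ext a b
  rw [Matrix.sum_apply, Matrix.mul_apply]
  refine Finset.sum_congr rfl fun i _ => ?_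
  simp [colMatrix, vecMulVec_apply, mul_diagonal]
  ring

lemma singularValue_nonneg (A : Matrix (Fin m) (Fin n) ℝ) (i : ℕ) : 0 ≤ singularValue A i :=
  LinearMap.singularValues_nonneg _ _

lemma singularValue_antitone (A : Matrix (Fin m) (Fin n) ℝ) : Antitone (singularValue A) :=
  LinearMap.singularValues_antitone _

lemma singularValue_eq_zero {A : Matrix (Fin m) (Fin n) ℝ} (hA : A.rank = k) {i : ℕ}
    (hi : k ≤ i) : singularValue A i = 0 := by
  rw [singularValue, LinearMap.singularValues_eq_zero_iff_le_finrank_range]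
  rwa [← hA, Matrix.rank_eq_finrank_range_toLin A (EuclideanSpace.basisFun _ ℝ).toBasis
    (EuclideanSpace.basisFun _ ℝ).toBasis, ← toEuclideanLin_eq_toLin_orthonormal] at hi

variable {A : Matrix (Fin m) (Fin n) ℝ} {u : Fin k → EuclideanSpace ℝ (Fin m)}
  {v : Fin k → EuclideanSpace ℝ (Fin n)}

lemma IsSingularSystem.isFactorization (h : IsSingularSystem A u v) :
    IsFactorization A (colMatrix u) (fun i => singularValue A i) (colMatrix v) :=
  ⟨colMatrix_isometry h.orthonormal_left, colMatrix_isometry h.orthonormal_right,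
    h.eq_sum.trans (sum_smul_vecMulVec u v _)⟩

lemma truncation_eq (A : Matrix (Fin m) (Fin n) ℝ) (u : Fin k → EuclideanSpace ℝ (Fin m))
    (v : Fin k → EuclideanSpace ℝ (Fin n)) (p : ℕ) :
    truncation A u v p = colMatrix u * ((1 - diagonal (tailMask k p)) *
      diagonal fun i : Fin k => singularValue A i) * (colMatrix v)ᵀ := by
  rw [← diagonal_one, diagonal_sub, diagonal_mul_diagonal, ← sum_smul_vecMulVec, truncation,
    Finset.sum_filter]
  refine Finset.sum_congr rfl fun i _ => ?_
  by_cases hi : (i : ℕ) < p <;> simp [tailMask, hi]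

lemma norm_sub_truncation_le (h : IsSingularSystem A u v) (p : ℕ) :
    ‖A - truncation A u v p‖ ≤ singularValue A p := by
  have e : A - truncation A u v p = colMatrix u *
      (diagonal (tailMask k p) * diagonal fun i : Fin k => singularValue A i) * (colMatrix v)ᵀ := by
    rw [truncation_eq]
    conv_lhs => enter [1]; rw [h.isFactorization.eq]
    simp only [Matrix.sub_mul, Matrix.mul_sub, Matrix.one_mul, sub_sub_cancel]
  rw [e, diagonal_mul_diagonal]
  have hd : ‖diagonal fun i : Fin k => tailMask k p i * singularValue A i‖ ≤ singularValue A p := by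
    refine l2_opNorm_diagonal_le (singularValue_nonneg _ _) fun i => ?_
    by_cases hi : (i : ℕ) < p
    · simpa [tailMask, hi] using singularValue_nonneg A p
    · simpa [tailMask, hi, abs_of_nonneg (singularValue_nonneg A _)] using
        singularValue_antitone A (not_lt.1 hi)
  simpa using l2_opNorm_mul_le (l2_opNorm_mul_le
    (l2_opNorm_le_one_of_isometry h.isFactorization.left) hd)
    ((l2_opNorm_transpose _).trans_le (l2_opNorm_le_one_of_isometry h.isFactorization.right))

variable (E : Matrix (Fin m) (Fin n) ℝ) (u : Fin k → EuclideanSpace ℝ (Fin m))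
  (v : Fin k → EuclideanSpace ℝ (Fin n))

lemma skewX_nonneg : 0 ≤ skewX E u v := Real.iSup_nonneg fun _ => abs_nonneg _

lemma skewY_nonneg : 0 ≤ skewY E u v :=
  Real.iSup_nonneg fun _ => (abs_nonneg _).trans (le_max_left _ _)

lemma abs_entry_le_skewX (i j : Fin k) :
    |((colMatrix u)ᵀ * E * colMatrix v) i j| ≤ skewX E u v := by
  have e : ((colMatrix u)ᵀ * E * colMatrix v) i j = (u i).ofLp ⬝ᵥ (E *ᵥ (v j).ofLp) := by
    rw [Matrix.mul_assoc]; rfl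
  rw [e]
  exact le_ciSup (f := fun q : Fin k × Fin k => |(u q.1).ofLp ⬝ᵥ (E *ᵥ (v q.2).ofLp)|)
    (Set.finite_range _).bddAbove (i, j)

lemma abs_gram_le_skewY {i j : Fin k} (hij : i < j) :
    |(E *ᵥ (v i).ofLp) ⬝ᵥ (E *ᵥ (v j).ofLp)| ≤ skewY E u v ∧
      |(Eᵀ *ᵥ (u i).ofLp) ⬝ᵥ (Eᵀ *ᵥ (u j).ofLp)| ≤ skewY E u v :=
  max_le_iff.1 <| le_ciSup (f := fun q : {q : Fin k × Fin k // q.1 < q.2} =>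
    max |(E *ᵥ (v q.1.1).ofLp) ⬝ᵥ (E *ᵥ (v q.1.2).ofLp)|
      |(Eᵀ *ᵥ (u q.1.1).ofLp) ⬝ᵥ (Eᵀ *ᵥ (u q.1.2).ofLp)|)
    (Set.finite_range _).bddAbove ⟨(i, j), hij⟩

/-- Serves both halves of `skewY`: M = E with the right vectors, and M = Eᵀ with the left ones. -/
lemma frob_offDiag_le {M : Matrix (Fin m) (Fin n) ℝ} {w : Fin k → EuclideanSpace ℝ (Fin n)} {y : ℝ}
    (hy : 0 ≤ y) (h : ∀ i j, i < j → |(M *ᵥ (w i).ofLp) ⬝ᵥ (M *ᵥ (w j).ofLp)| ≤ y) :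
    frob ((colMatrix w)ᵀ * Mᵀ * M * colMatrix w -
      diagonal (fun j => ((colMatrix w)ᵀ * Mᵀ * M * colMatrix w) j j)) ≤ k * y := by
  have e : ∀ i j, ((colMatrix w)ᵀ * Mᵀ * M * colMatrix w) i j =
      (M *ᵥ (w i).ofLp) ⬝ᵥ (M *ᵥ (w j).ofLp) := by
    intro i j
    rw [← transpose_mul, Matrix.mul_assoc]
    rfl
  have := frob_le_of_forall_le ((colMatrix w)ᵀ * Mᵀ * M * colMatrix w -
      diagonal (fun j => ((colMatrix w)ᵀ * Mᵀ * M * colMatrix w) j j)) hy fun i j => by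
    rw [Matrix.sub_apply, diagonal_apply]
    rcases lt_trichotomy i j with hij | rfl | hij
    · rw [if_neg hij.ne, sub_zero, e]
      exact h i j hij
    · simpa using hy
    · rw [if_neg hij.ne', sub_zero, e, dotProduct_comm]
      exact h j i hij
  simpa using this

/-- The arithmetic that combines the estimates. -/
lemma perturbation_arith {r p σ s δ x y e T D : ℝ} (hr1 : 1 ≤ r) (hp : p ≤ r)
    (hσ : 0 < σ) (hδ : 0 < δ) (hδs : δ = σ - s) (hx : 0 ≤ x) (hy : 0 ≤ y)
    (he : 0 ≤ e) (heσ : e ≤ σ / 96) (hre : r * e ^ 2 ≤ σ * δ / 9216) (hT : 0 ≤ T)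
    (h1 : 95 / 96 * δ * T ≤ 4 * (r * x) + 2 * (r * y + e ^ 2 * T) * (95 / 96 * σ)⁻¹
        + 2 * (√p * (e ^ 3 * (95 / 96 * σ)⁻¹ ^ 2)))
    (h2 : D ≤ 2 * e + s * T + (s + e) * (e * (95 / 96 * σ)⁻¹ + T)) :
    D ≤ 32 * σ * (e / σ + r * x / δ + r ^ 2 * y / (σ * δ)) := by
  have hinv : (95 / 96 * σ)⁻¹ = 96 / 95 * σ⁻¹ := by rw [mul_inv]; norm_num
  rw [hinv] at h1 h2
  set i := σ⁻¹ with hi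
  have hi0 : 0 < i := inv_pos.2 hσ
  have hσi : σ * i = 1 := mul_inv_cancel₀ hσ.ne'
  have hsp : √p ≤ r := (Real.sqrt_le_left (by linarith)).2 (by nlinarith)
  have he2 : e ^ 2 ≤ σ * δ / 9216 := le_trans (by nlinarith [sq_nonneg e]) hre
  -- the two absorbed terms
  have a1 : e ^ 2 * T * i ≤ δ / 9216 * T := by
    have := mul_le_mul_of_nonneg_right he2 (mul_nonneg hT hi0.le)
    calc e ^ 2 * T * i = e ^ 2 * (T * i) := by ring
      _ ≤ σ * δ / 9216 * (T * i) := this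
      _ = (σ * i) * (δ / 9216 * T) := by ring
      _ = δ / 9216 * T := by rw [hσi, one_mul]
  have a2 : √p * (e ^ 3 * i ^ 2) ≤ δ / 9216 * (e * i) := by
    calc √p * (e ^ 3 * i ^ 2) ≤ r * (e ^ 3 * i ^ 2) :=
          mul_le_mul_of_nonneg_right hsp (by positivity)
      _ = r * e ^ 2 * (e * i ^ 2) := by ring
      _ ≤ σ * δ / 9216 * (e * i ^ 2) := mul_le_mul_of_nonneg_right hre (by positivity)
      _ = (σ * i) * (δ / 9216 * (e * i)) := by ring
      _ = δ / 9216 * (e * i) := by rw [hσi, one_mul]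
  have hry : r * y ≤ r ^ 2 * y := mul_le_mul_of_nonneg_right (by nlinarith) hy
  have a3 : r * y * i ≤ r ^ 2 * y * i := mul_le_mul_of_nonneg_right hry hi0.le
  -- After absorption δT keeps a coefficient above 0.98; dividing by it, 4 is rounded up to 5 and
  -- 192/95 to 3.
  have b1 : δ * T ≤ 5 * (r * x) + 3 * (r ^ 2 * y * i) + δ * (e * i) := by
    have hxx : 0 ≤ r * x := by positivity
    have hyy : 0 ≤ r ^ 2 * y * i := by positivity
    have hei : 0 ≤ δ * (e * i) := by positivity
    have hdT : 0 ≤ δ * T := by positivity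
    have e1 : 2 * (r * y + e ^ 2 * T) * (96 / 95 * i) =
        192 / 95 * (r * y * i) + 192 / 95 * (e ^ 2 * T * i) := by ring
    have e2 : 2 * (√p * (e ^ 3 * (96 / 95 * i) ^ 2)) =
        2 * (96 / 95) ^ 2 * (√p * (e ^ 3 * i ^ 2)) := by ring
    rw [e1, e2] at h1
    nlinarith
  have b2 : σ * T ≤ 5 * (r * x * σ / δ) + 3 * (r ^ 2 * y / δ) + e := by
    have h3 : δ * (σ * T) ≤ δ * (5 * (r * x * σ / δ) + 3 * (r ^ 2 * y / δ) + e) := by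
      have e1 : δ * (5 * (r * x * σ / δ) + 3 * (r ^ 2 * y / δ) + e) =
          5 * (r * x * σ) + 3 * (r ^ 2 * y) + δ * e := by
        field_simp
      rw [e1]
      have := mul_le_mul_of_nonneg_left b1 hσ.le
      have e2 : σ * (5 * (r * x) + 3 * (r ^ 2 * y * i) + δ * (e * i)) =
          5 * (r * x * σ) + 3 * (r ^ 2 * y) * (σ * i) + δ * e * (σ * i) := by ring
      rw [e2, hσi] at this
      linarith
    exact le_of_mul_le_mul_left h3 hδ
  have hsσ : s ≤ σ := by linarith
  have c1 : s * T ≤ σ * T := mul_le_mul_of_nonneg_right hsσ hT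
  have c2 : (s + e) * (e * (96 / 95 * i) + T) ≤ 2 * σ * (e * (96 / 95 * i) + T) :=
    mul_le_mul_of_nonneg_right (by linarith) (by positivity)
  have c3 : 2 * σ * (e * (96 / 95 * i) + T) = 192 / 95 * e * (σ * i) + 2 * (σ * T) := by ring
  rw [c3, hσi] at c2
  have d1 : 32 * σ * (e / σ + r * x / δ + r ^ 2 * y / (σ * δ)) =
      32 * e + 32 * (r * x * σ / δ) + 32 * (r ^ 2 * y / δ) := by
    field_simp
  have d2 : 0 ≤ r * x * σ / δ := by positivity
  have d3 : 0 ≤ r ^ 2 * y / δ := by positivity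
  rw [d1]
  linarith

end Main

end LowRankPerturbation

/-! ### The perturbation theorem -/

open Matrix LowRankPerturbation in
theorem mainTheorem1 {m n r r' : ℕ} (A E : Matrix (Fin m) (Fin n) ℝ)
    (hr : A.rank = r) (hr' : (A + E).rank = r')
    (u : Fin r → EuclideanSpace ℝ (Fin m)) (v : Fin r → EuclideanSpace ℝ (Fin n))
    (hA : LowRankPerturbation.IsSingularSystem A u v)
    (u' : Fin r' → EuclideanSpace ℝ (Fin m)) (v' : Fin r' → EuclideanSpace ℝ (Fin n))
    (hA' : LowRankPerturbation.IsSingularSystem (A + E) u' v')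
    (p : ℕ) (hp : 1 ≤ p) (hpr : p ≤ r)
    (σ δ x y : ℝ)
    (hσ : σ = LowRankPerturbation.singularValue A (p - 1))
    (hδ : δ = LowRankPerturbation.singularGap A p)
    (hx : x = LowRankPerturbation.skewX E u v)
    (hy : y = LowRankPerturbation.skewY E u v)
    (hgap : 0 < δ)
    (hmax : max (p * ‖E‖ / σ) (max ((r : ℝ) ^ 2 * x / δ) (√r * ‖E‖ / √(σ * δ))) ≤ 1 / 96) :
    ‖LowRankPerturbation.truncation (A + E) u' v' p - LowRankPerturbation.truncation A u v p‖ ≤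
      32 * σ * (‖E‖ / σ + r * x / δ + (r : ℝ) ^ 2 * y / (σ * δ)) := by
  -- Indices start at 0: σ_p is the value at i, and σ_{p+1}, called s below, the value at i + 1.
  obtain ⟨i, rfl⟩ : ∃ i, p = i + 1 := ⟨p - 1, by omega⟩
  rw [singularGap, Nat.add_sub_cancel] at hδ
  rw [Nat.add_sub_cancel] at hσ
  set s := singularValue A (i + 1) with hs
  have hs0 : 0 ≤ s := singularValue_nonneg _ _
  rw [← hσ] at hδ
  have hσ0 : 0 < σ := by linarith
  have hx0 : 0 ≤ x := hx ▸ skewX_nonneg E u v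
  have hy0 : 0 ≤ y := hy ▸ skewY_nonneg E u v
  have he0 := norm_nonneg E
  obtain ⟨m1, m2⟩ := max_le_iff.1 hmax
  obtain ⟨m2, m3⟩ := max_le_iff.1 m2
  have hp1 : (1 : ℝ) ≤ (i + 1 : ℕ) := by exact_mod_cast hp
  have hpr1 : ((i + 1 : ℕ) : ℝ) ≤ r := by exact_mod_cast hpr
  have hr1 : (1 : ℝ) ≤ r := hp1.trans hpr1
  have heσ : ‖E‖ ≤ σ / 96 := by
    rw [div_le_iff₀ hσ0] at m1
    nlinarith
  have hrx : (r : ℝ) * x ≤ δ / 96 := by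
    rw [div_le_iff₀ hgap] at m2
    have : (r : ℝ) * x ≤ (r : ℝ) ^ 2 * x := mul_le_mul_of_nonneg_right (by nlinarith) hx0
    linarith
  have hre : (r : ℝ) * ‖E‖ ^ 2 ≤ σ * δ / 9216 := by
    have hpos : 0 < σ * δ := mul_pos hσ0 hgap
    rw [div_le_iff₀ (Real.sqrt_pos.2 hpos)] at m3
    have := pow_le_pow_left₀ (by positivity) m3 2
    rw [mul_pow, mul_pow, Real.sq_sqrt (by positivity), Real.sq_sqrt hpos.le] at this
    linarith
  have hF := hA.isFactorization
  have hF' := hA'.isFactorization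
  have hlow : σ - δ / 96 ≤ singularValue (A + E) i := by
    have h1 := hF.sub_le_of_entries (singularValue_antitone A) (singularValue_nonneg A) hF'
      (singularValue_antitone _) (singularValue_nonneg _) hx0
      (fun a b => hx ▸ abs_entry_le_skewX E u v a b) hpr
    have h2 := mul_le_mul_of_nonneg_right hpr1 hx0
    rw [← hσ] at h1
    linarith
  -- Otherwise the p-th singular value of A + E would vanish, against `hlow` and δ ≤ σ.
  have hpr' : i + 1 ≤ r' := by
    by_contra! hlt
    rw [singularValue_eq_zero hr' (by omega)] at hlow
    linarith
  have hB := hF'.isSingularFamily hpr'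
  have hup : singularValue (A + E) (i + 1) ≤ s + ‖E‖ := by
    have := hF.weyl (singularValue_antitone A) (singularValue_nonneg A) hF'
      (singularValue_antitone _) (singularValue_nonneg _)
      (fun j hj => singularValue_eq_zero hr' hj) (i + 1)
    rwa [add_sub_cancel_left] at this
  have hτ : ∀ j : Fin (i + 1),
      σ - δ / 96 ≤ singularValue (A + E) (Fin.castLE hpr' j : Fin r') := fun j =>
    hlow.trans (singularValue_antitone _ (by simpa using Nat.le_of_lt_succ j.2))
  have ht : 0 < 95 / 96 * σ := by linarith
  have hτt : ∀ j : Fin (i + 1),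
      95 / 96 * σ ≤ singularValue (A + E) (Fin.castLE hpr' j : Fin r') := fun j =>
    le_trans (by linarith) (hτ j)
  have hq : ∀ j, tailMask r (i + 1) j = 0 ∨ tailMask r (i + 1) j = 1 := fun j => by
    simp only [tailMask]; split_ifs <;> simp
  have htail : ∀ j, tailMask r (i + 1) j = 1 → singularValue A j ≤ s := fun j hj => by
    refine singularValue_antitone A (not_lt.1 fun hlt => ?_)
    simp [tailMask, hlt] at hj
  have hX : frob ((colMatrix u)ᵀ * E * colMatrix v) ≤ r * x := by
    have h := frob_le_of_forall_le _ hx0 fun a b => hx ▸ abs_entry_le_skewX E u v a b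
    rwa [Fintype.card_fin] at h
  -- The gap constant is (σ - δ/96) - s = (95/96)δ.
  obtain ⟨T, hT1, hT2, hT⟩ := exists_frob_mask_le hF hB hτt ht le_rfl (by linarith) hq
    (X := r * x) (Y := r * y) (d := 95 / 96 * δ) (fun j => singularValue_nonneg A j)
    (fun j l hj => by have := hτ l; have := htail j hj; linarith) (by linarith) hX
    (by simpa using frob_offDiag_le (M := Eᵀ) hy0
          (fun a b hab => hy ▸ (abs_gram_le_skewY E u v hab).2))
    (frob_offDiag_le hy0 fun a b hab => hy ▸ (abs_gram_le_skewY E u v hab).1)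
  have htr : truncation (A + E) u' v' (i + 1) = _ :=
    (truncation_eq _ _ _ _).trans (select_mul_diagonal_mul hpr' _ _ _).symm
  have hD := norm_truncation_sub_le hF hB hτt ht le_rfl hq (s := s) (ρ := s + ‖E‖)
    (fun j => by
      rcases hq j with h | h
      · simpa [h] using hs0
      · rw [h, one_mul, abs_of_nonneg (singularValue_nonneg _ _)]; exact htail j h) hs0
    (isometry_mul_select hpr hF.right)
    (by rw [← select_mul_transpose hpr, transpose_mul]; simp only [Matrix.mul_assoc])
    (by rw [← htr]; exact (norm_sub_truncation_le hA' _).trans hup) hT1 hT2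
  rw [← htr, ← truncation_eq] at hD
  rw [Fintype.card_fin] at hT
  exact perturbation_arith hr1 hpr1 hσ0 hgap hδ hx0 hy0 he0 heσ hre
    ((frob_nonneg _).trans hT1) hT hD
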